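/- Graphs are finite and may have loops but no multiple edges. For a graph $G$ with vertex set $V=V(G)$, let $A(G)$ be its $V\times V$ adjacency matrix over $GF(2)$ (a loop at $v$ gives the diagonal entry $1$ at $v$), and let $n(A)$ denote the nullity of a matrix $A$ over $GF(2)$. For $X\subseteq V$, let $G[X]$ be the subgraph of $G$ induced by $X$, and let $G+X$ be the graph obtained from $G$ by toggling the existence of a loop at each vertex of $X$; $G+Y[X]$ means $(G+Y)[X]$. The interlace polynomial and the global interlace polynomial of $G$ are $$q(G;y)=\sum_{X\subseteq V}(y-1)^{n(A(G[X]))},\qquad Q(G;y)=\sum_{X\subseteq V}\ \sum_{Y\subseteq X}(y-2)^{n(A(G+Y[X]))}.$$ A graph is simple if it has no loops. A simple graph is Eulerian if every vertex is adjacent to an even number of vertices (connectedness is not required, and the empty graph is Eulerian). For simple $G$, let $\mathrm{Eul}(G)=\{X\subseteq V : G[X]\text{ is Eulerian}\}$, let $N_G(v)$ be the set of vertices adjacent to $v$, and for $X\subseteq V$ let $\mathrm{even}_G(X)$ be the set of vertices in $V\setminus X$ that are adjacent to an even number of vertices of $X$. **Corollary.** Let $G$ be a graph with vertex set $V$. Then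 $q(G;3)=k\,|q(G;-1)|$ for some odd integer $k$. If $G$ is moreover simple, then 1. $Q(G;4)=|\mathrm{Eul}(G)|\cdot 2^{|V|}$; 2. $Q(G;6)=\sum_{X_1,X_2\in\mathrm{Eul}(G)}2^{|\mathrm{PN}(X_1,X_2)|}$, where $\mathrm{PN}(X_1,X_2)=\{v\in V\setminus(X_1\mathbin{\Delta}X_2) : |N_G(v)\cap X_1|\equiv|N_G(v)\cap X_2| \pmod 2\}$; 3. $Q(G;-2)=(-1)^{|V|}\sum_{X\in\mathrm{Eul}(G)}(-2)^{\,n(A(G+\mathrm{even}_G(X)[V\setminus X]))}$. -/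

import Mathlib

/-- A graph on the vertex set `V` in which loops, but no multiple edges, are allowed:
a symmetric relation `Adj`, with `Adj v v` meaning that there is a loop at `v`. -/
structure LoopGraph (V : Type*) where
  Adj : V → V → Prop
  symm : ∀ x y, Adj x y → Adj y x

namespace LoopGraph

/-- The adjacency matrix of `G` over `GF(2)`; loops give diagonal entries equal to one. -/
noncomputable def adjMatrix {V : Type*} (G : LoopGraph V) : Matrix V V (ZMod 2) :=
  open Classical in Matrix.of fun x y => if G.Adj x y then 1 else 0

/-- The nullity (dimension of the kernel over `GF(2)`) of the adjacency matrix of `G`. -/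
noncomputable def nullity {V : Type*} [Fintype V] (G : LoopGraph V) : ℕ :=
  Module.finrank (ZMod 2) (LinearMap.ker G.adjMatrix.mulVecLin)

/-- The induced subgraph `G[X]`, with vertex set `X`. -/
def induce {V : Type*} (G : LoopGraph V) (X : Finset V) : LoopGraph X where
  Adj x y := G.Adj x y
  symm x y h := G.symm x y h

/-- The graph `G + X`: the existence of a loop is toggled at every vertex of `X`. -/
def toggleLoops {V : Type*} (G : LoopGraph V) (X : Finset V) : LoopGraph V where
  Adj x y := Xor (G.Adj x y) (x = y ∧ x ∈ X)
  symm x y h := by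
    rcases h with ⟨h₁, h₂⟩ | ⟨⟨rfl, h₁⟩, h₂⟩
    · exact Or.inl ⟨G.symm x y h₁, fun ⟨e, h₃⟩ => h₂ ⟨e.symm, e ▸ h₃⟩⟩
    · exact Or.inr ⟨⟨rfl, h₁⟩, h₂⟩

/-- A simple graph is a graph without loops. -/
def IsSimple {V : Type*} (G : LoopGraph V) : Prop :=
  ∀ v, ¬ G.Adj v v

/-- The neighbourhood `N_G(v)`, the set of vertices adjacent to `v`. -/
noncomputable def neighbors {V : Type*} [Fintype V] (G : LoopGraph V) (v : V) : Finset V :=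
  open Classical in Finset.univ.filter fun w => G.Adj v w

/-- An Eulerian graph: a simple graph in which every vertex has an even number of neighbours.
Connectedness is not required and the empty graph is Eulerian. -/
def IsEulerian {V : Type*} [Fintype V] (G : LoopGraph V) : Prop :=
  G.IsSimple ∧ ∀ v, Even (G.neighbors v).card

/-- `Eul(G)`, the family of vertex sets that induce an Eulerian subgraph. -/
noncomputable def eul {V : Type*} [Fintype V] (G : LoopGraph V) : Finset (Finset V) :=
  open Classical in Finset.univ.filter fun X => (G.induce X).IsEulerian

/-- `even_G(X)`, the vertices outside `X` that have an even number of neighbours in `X`. -/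
noncomputable def evenSet {V : Type*} [Fintype V] [DecidableEq V] (G : LoopGraph V)
    (X : Finset V) : Finset V :=
  (Finset.univ \ X).filter fun v => Even (G.neighbors v ∩ X).card

/-- `PN(X₁, X₂)`, the vertices outside the symmetric difference of `X₁` and `X₂` whose numbers of
neighbours in `X₁` and in `X₂` have the same parity. -/
noncomputable def PN {V : Type*} [Fintype V] [DecidableEq V] (G : LoopGraph V)
    (X₁ X₂ : Finset V) : Finset V :=
  (Finset.univ \ symmDiff X₁ X₂).filter fun v =>
    (G.neighbors v ∩ X₁).card ≡ (G.neighbors v ∩ X₂).card [MOD 2]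

/-- The interlace polynomial `q(G; y)`. -/
noncomputable def interlacePoly {V : Type*} [Fintype V] (G : LoopGraph V) : Polynomial ℤ :=
  ∑ X : Finset V, (Polynomial.X - 1) ^ (G.induce X).nullity

/-- The global interlace polynomial `Q(G; y)`; the exponent is the nullity of `A((G + Y)[X])`. -/
noncomputable def globalInterlacePoly {V : Type*} [Fintype V] (G : LoopGraph V) : Polynomial ℤ :=
  ∑ X : Finset V, ∑ Y ∈ X.powerset, (Polynomial.X - 2) ^ ((G.toggleLoops Y).induce X).nullity

end LoopGraph

/-! The vectors `graphVec A x` form a Lagrangian subspace `L` of the symplectic space of functions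
from `V` to `GF(2)²`. A pair `Y ⊆ X` amounts to choosing, at each vertex, one of the three lines of
`GF(2)²`, and the nullity of `(G + Y)[X]` is the dimension `d(T)` of the intersection of `L` with
the product of the chosen lines (`nullity_toggleLoops_induce`). So `q` and `Q` are sums of powers
over line choices `T`. Two tools evaluate them.

Powers of 2: `2 ^ d(T)` counts points of `L`, and since `L` is self-dual, Poisson summation
(`sum_prod_sympFourier`) replaces a product weight on `L` by its Fourier transform, vertex by
vertex.

Powers of -2: changing the line at one vertex gives dimensions `d, d, d + 1` in some order, so the
three values of `(-2) ^ d` sum to zero. Hence coefficients matter only up to a constant on the three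
lines at each vertex (`sum_prod_mul_signedCount_congr`).

The Eulerian sets are the points of `L` that avoid `(1, 1)` at every vertex. For simple `G` the form
of `A` is alternating, so the signs produced by the transforms multiply to 1. The oddness of `k`
comes from the symmetry of a sum over pairs in the image of `A + 1`. -/

namespace LoopGraph

open Finset Matrix

/-! ### Characters and Poisson summation on the Lagrangian subspace -/

/-- The nontrivial additive character of `GF(2)`, with values in `ℤ`. -/
def sign (a : ZMod 2) : ℤ := if a = 0 then 1 else -1

theorem sign_add (a b : ZMod 2) : sign (a + b) = sign a * sign b := by
  revert a b; decide

theorem sign_sum {ι : Type*} (s : Finset ι) (f : ι → ZMod 2) :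
    sign (∑ i ∈ s, f i) = ∏ i ∈ s, sign (f i) := by
  classical
  induction s using Finset.induction_on with
  | empty => simp [sign]
  | insert a s ha ih => rw [sum_insert ha, prod_insert ha, sign_add, ih]

/-- The symplectic form on `GF(2)²`. -/
def symp (z w : ZMod 2 × ZMod 2) : ZMod 2 := z.1 * w.2 + z.2 * w.1

variable {V : Type*} [Fintype V] [DecidableEq V]

theorem sum_sign_dotProduct (y : V → ZMod 2) :
    ∑ x : V → ZMod 2, sign (x ⬝ᵥ y) = if y = 0 then 2 ^ Fintype.card V else 0 := by
  have h1 : ∀ x : V → ZMod 2, sign (x ⬝ᵥ y) = ∏ v, sign (x v * y v) := fun x => by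
    rw [dotProduct, sign_sum]
  simp_rw [h1]
  have h := Finset.prod_univ_sum (fun _ : V => (univ : Finset (ZMod 2)))
    (fun v t => sign (t * y v))
  rw [Fintype.piFinset_univ] at h
  rw [← h]
  have h2 : ∀ b : ZMod 2, ∑ t : ZMod 2, sign (t * b) = if b = 0 then 2 else 0 := by decide
  simp_rw [h2]
  split_ifs with hy
  · subst hy; simp
  · obtain ⟨v, hv⟩ := Function.ne_iff.mp hy
    exact prod_eq_zero (mem_univ v) (by simpa using hv)

/-- The vector of pairs `(x v, (A x) v)`. These vectors form a Lagrangian subspace if `A` is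
symmetric. -/
def graphVec (A : Matrix V V (ZMod 2)) (x : V → ZMod 2) (v : V) : ZMod 2 × ZMod 2 :=
  (x v, (A *ᵥ x) v)

/-- The vectors `x` such that `graphVec A x v` lies on the line of `T v` for all `v`. -/
def lineSpace (A : Matrix V V (ZMod 2)) (T : V → ZMod 2 × ZMod 2) :
    Submodule (ZMod 2) (V → ZMod 2) where
  carrier := {x | ∀ v, symp (graphVec A x v) (T v) = 0}
  zero_mem' := by intro v; simp [symp, graphVec]
  add_mem' := by
    intro x y hx hy v
    have := congrArg₂ (· + ·) (hx v) (hy v)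
    simp only [symp, graphVec, mulVec_add, Pi.add_apply] at this ⊢
    linear_combination this
  smul_mem' := by
    intro c x hx v
    have := congrArg (c * ·) (hx v)
    simp only [symp, graphVec, mulVec_smul, Pi.smul_apply, smul_eq_mul] at this ⊢
    linear_combination this

omit [DecidableEq V] in
theorem mem_lineSpace {A : Matrix V V (ZMod 2)} {T : V → ZMod 2 × ZMod 2} {x : V → ZMod 2} :
    x ∈ lineSpace A T ↔ ∀ v, symp (graphVec A x v) (T v) = 0 := Iff.rfl

/-- The indicator function of the line spanned by `t`, if `t ≠ 0`. -/
def onLine (t z : ZMod 2 × ZMod 2) : ℤ := if symp z t = 0 then 1 else 0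

omit [DecidableEq V] in
theorem card_submodule_eq_two_pow (S : Submodule (ZMod 2) (V → ZMod 2)) :
    Nat.card S = 2 ^ Module.finrank (ZMod 2) S := by
  have := Module.natCard_eq_pow_finrank (K := ZMod 2) (V := S)
  simpa using this

theorem two_pow_finrank_lineSpace (A : Matrix V V (ZMod 2)) (T : V → ZMod 2 × ZMod 2) :
    (2 : ℤ) ^ Module.finrank (ZMod 2) (lineSpace A T) =
      ∑ x, ∏ v, onLine (T v) (graphVec A x v) := by
  classical
  have h := card_submodule_eq_two_pow (lineSpace A T)
  have h2 : (Nat.card (lineSpace A T) : ℤ) = 2 ^ Module.finrank (ZMod 2) (lineSpace A T) := by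
    rw [h]; push_cast; rfl
  rw [← h2]
  simp_rw [onLine, Finset.prod_ite_zero, prod_const_one, sum_boole]
  rw [Nat.card_eq_fintype_card, Fintype.card_subtype]
  simp [mem_lineSpace]

/-- Poisson summation: for fixed `z` the sum over `x` is a character sum, which vanishes unless `z`
is orthogonal to `L`. As `L` is Lagrangian, this means `z ∈ L`. -/
theorem sum_prod_symp (A : Matrix V V (ZMod 2)) (hA : A.IsSymm)
    (f : (V → ZMod 2 × ZMod 2) → ℤ) :
    ∑ x, ∑ z, (∏ v, sign (symp (z v) (graphVec A x v))) * f z =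
      2 ^ Fintype.card V * ∑ x, f (graphVec A x) := by
  rw [sum_comm]
  simp_rw [← sum_mul]
  have h1 : ∀ (z : V → ZMod 2 × ZMod 2) (x : V → ZMod 2),
      ∏ v, sign (symp (z v) (graphVec A x v)) =
        sign (x ⬝ᵥ fun v => (A *ᵥ fun u => (z u).1) v + (z v).2) := by
    intro z x
    rw [← sign_sum]
    congr 1
    have e : x ⬝ᵥ A *ᵥ (fun u => (z u).1) = (fun u => (z u).1) ⬝ᵥ A *ᵥ x := by
      rw [dotProduct_mulVec, ← mulVec_transpose, hA.eq, dotProduct_comm]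
    simp only [dotProduct, symp, graphVec, mul_add, sum_add_distrib] at e ⊢
    rw [e]
    simp [mul_comm]
  simp_rw [h1, sum_sign_dotProduct]
  rw [mul_sum, ← (Equiv.arrowProdEquivProdArrow V (fun _ => ZMod 2) (fun _ => ZMod 2)).symm.sum_comp,
    Fintype.sum_prod_type]
  refine sum_congr rfl fun p _ => ?_
  rw [Finset.sum_eq_single (A *ᵥ p)]
  · rw [if_pos]
    · rfl
    · ext v
      exact CharTwo.add_self_eq_zero _
  · intro q _ hq
    rw [if_neg, zero_mul]
    intro h
    apply hq
    ext v
    exact (CharTwo.add_eq_zero.mp (congrFun h v)).symm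
  · simp

/-- The symplectic Fourier transform of a function on `GF(2)²`. -/
def sympFourier (f : ZMod 2 × ZMod 2 → ℤ) (w : ZMod 2 × ZMod 2) : ℤ :=
  ∑ z, sign (symp z w) * f z

theorem sum_prod_eq_prod_sum {α : Type*} [Fintype α] (f : V → α → ℤ) :
    ∑ z : V → α, ∏ v, f v (z v) = ∏ v, ∑ t, f v t := by
  have h := Finset.prod_univ_sum (fun _ : V => (univ : Finset α)) f
  rw [Fintype.piFinset_univ] at h
  exact h.symm

theorem sum_prod_sympFourier (A : Matrix V V (ZMod 2)) (hA : A.IsSymm)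
    (f : V → ZMod 2 × ZMod 2 → ℤ) :
    ∑ x, ∏ v, sympFourier (f v) (graphVec A x v) =
      2 ^ Fintype.card V * ∑ x, ∏ v, f v (graphVec A x v) := by
  rw [← sum_prod_symp A hA (fun z => ∏ v, f v (z v))]
  simp_rw [← prod_mul_distrib, sympFourier]
  refine sum_congr rfl fun x _ => ?_
  rw [sum_prod_eq_prod_sum (fun v t => sign (symp t (graphVec A x v)) * f v t)]

/-! ### The three-term relation for powers of -2 -/

theorem sum_eq_sum_sum_update {α : Type*} [Fintype α] (v : V) (g : (V → α) → ℤ) :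
    (Fintype.card α : ℤ) * ∑ z, g z = ∑ z, ∑ t, g (Function.update z v t) := by
  classical
  have h : ∀ s : α, ∑ z : V → α, (if z v = s then ∑ t, g (Function.update z v t) else 0)
      = ∑ z, g z := by
    intro s
    rw [← sum_filter, sum_sigma']
    refine sum_bij' (fun p _ => Function.update p.1 v p.2)
      (fun z _ => ⟨Function.update z v s, z v⟩) ?_ ?_ ?_ ?_ ?_
    · simp
    · simp
    · rintro ⟨z, t⟩ h
      simp only [mem_sigma, mem_filter, mem_univ, true_and, and_true] at h
      subst h; simp
    · simp
    · simp
  rw [← nsmul_eq_mul, ← Finset.card_univ, ← sum_const]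
  rw [sum_congr rfl fun s _ => (h s).symm, sum_comm]
  simp

/-- A sum against a product of coefficients depends only on the values of the coefficient
functions on the lines in the coordinate directions. -/
theorem sum_prod_mul_congr {α : Type*} [Fintype α] [Nonempty α] (F : (V → α) → ℤ)
    (c c' : V → α → ℤ)
    (h : ∀ v z, ∑ t, c v t * F (Function.update z v t) = ∑ t, c' v t * F (Function.update z v t)) :
    ∑ z, (∏ v, c v (z v)) * F z = ∑ z, (∏ v, c' v (z v)) * F z := by
  suffices H : ∀ S : Finset V, ∑ z, (∏ v, if v ∈ S then c' v (z v) else c v (z v)) * F z =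
      ∑ z, (∏ v, c v (z v)) * F z by
    have := H univ
    simpa using this.symm
  intro S
  -- Exchange `c` for `c'` one coordinate at a time; summing over coordinate lines costs a factor
  -- `Fintype.card α`, cancelled below.
  induction S using Finset.induction_on with
  | empty => simp
  | insert a S ha ih =>
    rw [← ih]
    have hc : (Fintype.card α : ℤ) ≠ 0 := by exact_mod_cast Fintype.card_ne_zero
    apply mul_left_cancel₀ hc
    rw [sum_eq_sum_sum_update a, sum_eq_sum_sum_update a]
    refine sum_congr rfl fun z _ => ?_
    have e1 : ∀ t, (∏ v, if v ∈ insert a S then c' v (Function.update z a t v)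
        else c v (Function.update z a t v)) =
        (∏ v ∈ univ.erase a, if v ∈ S then c' v (z v) else c v (z v)) * c' a t := by
      intro t
      rw [← mul_prod_erase univ _ (mem_univ a), mul_comm]
      congr 1
      · refine prod_congr rfl fun v hv => ?_
        have := ne_of_mem_erase hv
        simp [this]
      · simp
    have e2 : ∀ t, (∏ v, if v ∈ S then c' v (Function.update z a t v)
        else c v (Function.update z a t v)) =
        (∏ v ∈ univ.erase a, if v ∈ S then c' v (z v) else c v (z v)) * c a t := by
      intro t
      rw [← mul_prod_erase univ _ (mem_univ a), mul_comm]
      congr 1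
      · refine prod_congr rfl fun v hv => ?_
        have := ne_of_mem_erase hv
        simp [this]
      · simp [ha]
    simp_rw [e1, e2, mul_assoc, ← mul_sum, h]

/-- The exponents must be `d, d, d + 1` in some order: halve until one of them is 0, and then parity
leaves only `0, 0, 1`. -/
theorem neg_two_pow_add_eq_zero {a b c e : ℕ} (h : 2 ^ a + 2 ^ b + 2 ^ c = 2 ^ e) :
    (-2 : ℤ) ^ a + (-2) ^ b + (-2) ^ c = 0 := by
  have key : ∀ b c e : ℕ, 1 + 2 ^ b + 2 ^ c = 2 ^ e → (b = 0 ∧ c = 1) ∨ (b = 1 ∧ c = 0) := by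
    intro b c e h
    rcases e with _ | _ | e
    · have := Nat.one_le_two_pow (n := b)
      have := Nat.one_le_two_pow (n := c)
      omega
    · have := Nat.one_le_two_pow (n := b)
      have := Nat.one_le_two_pow (n := c)
      omega
    · rcases b with _ | _ | b <;> rcases c with _ | _ | c <;> simp_all [pow_succ] <;> omega
  induction e generalizing a b c with
  | zero =>
    have := Nat.one_le_two_pow (n := a)
    have := Nat.one_le_two_pow (n := b)
    have := Nat.one_le_two_pow (n := c)
    omega
  | succ e ih =>
    rcases a with _ | a
    · rcases key b c (e + 1) (by simpa using h) with ⟨rfl, rfl⟩ | ⟨rfl, rfl⟩ <;> norm_num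
    rcases b with _ | b
    · rcases key (a + 1) c (e + 1) (by rw [← h]; ring) with ⟨h1, h2⟩ | ⟨h1, h2⟩ <;>
        rw [h1, h2] <;> norm_num
    rcases c with _ | c
    · rcases key (a + 1) (b + 1) (e + 1) (by rw [← h]; ring) with ⟨h1, h2⟩ | ⟨h1, h2⟩ <;>
        rw [h1, h2] <;> norm_num
    have := ih (a := a) (b := b) (c := c) (by simp only [pow_succ] at h; omega)
    linear_combination (-2) * this

theorem sum_pair_eq {M : Type*} [AddCommMonoid M] (f : ZMod 2 × ZMod 2 → M) :
    ∑ t, f t = f (0, 0) + f (0, 1) + f (1, 0) + f (1, 1) := by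
  rw [show (univ : Finset (ZMod 2 × ZMod 2)) = {(0, 0), (0, 1), (1, 0), (1, 1)} from rfl]
  rw [sum_insert (by decide), sum_insert (by decide), sum_insert (by decide), sum_singleton]
  simp only [add_assoc]

theorem sympFourier_onLine (t w : ZMod 2 × ZMod 2) (ht : t ≠ 0) :
    sympFourier (onLine t) w = 2 * onLine t w := by
  revert t w; decide

theorem sympFourier_one (w : ZMod 2 × ZMod 2) :
    sympFourier (fun _ => 1) w = 4 * if w = 0 then 1 else 0 := by
  revert w; decide

theorem sum_onLine (w : ZMod 2 × ZMod 2) :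
    onLine (0, 1) w + onLine (1, 0) w + onLine (1, 1) w = 1 + 2 * if w = 0 then 1 else 0 := by
  revert w; decide

theorem prod_update_onLine (A : Matrix V V (ZMod 2)) (T : V → ZMod 2 × ZMod 2) (v : V)
    (t : ZMod 2 × ZMod 2) (x : V → ZMod 2) :
    ∏ u, onLine (Function.update T v t u) (graphVec A x u) =
      onLine t (graphVec A x v) * ∏ u ∈ univ.erase v, onLine (T u) (graphVec A x u) := by
  rw [← mul_prod_erase univ _ (mem_univ v)]
  congr 1
  · simp
  · refine prod_congr rfl fun u hu => ?_
    simp [ne_of_mem_erase hu]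

/-- Poisson summation with the constant 1 at `v`. The transform gives 4 times the indicator of 0 at
`v` and 2 times the same line elsewhere, one factor 2 more than `2 ^ Fintype.card V`. -/
theorem two_mul_sum_eq_sum (A : Matrix V V (ZMod 2)) (hA : A.IsSymm) (T : V → ZMod 2 × ZMod 2)
    (v : V) (hT : ∀ u ≠ v, T u ≠ 0) :
    2 * ∑ x, (if graphVec A x v = 0 then 1 else 0) *
        ∏ u ∈ univ.erase v, onLine (T u) (graphVec A x u) =
      ∑ x, ∏ u ∈ univ.erase v, onLine (T u) (graphVec A x u) := by
  have h := sum_prod_sympFourier A hA fun u => if u = v then fun _ => 1 else onLine (T u)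
  have e1 : ∀ x : V → ZMod 2,
      ∏ u, (if u = v then fun _ => 1 else onLine (T u)) (graphVec A x u) =
        ∏ u ∈ univ.erase v, onLine (T u) (graphVec A x u) := by
    intro x
    rw [← mul_prod_erase univ _ (mem_univ v)]
    simp only [if_true, one_mul]
    refine prod_congr rfl fun u hu => ?_
    simp [ne_of_mem_erase hu]
  have e2 : ∀ x : V → ZMod 2,
      ∏ u, sympFourier (if u = v then fun _ => 1 else onLine (T u)) (graphVec A x u) =
        2 ^ Fintype.card V * (2 * ((if graphVec A x v = 0 then 1 else 0) *
          ∏ u ∈ univ.erase v, onLine (T u) (graphVec A x u))) := by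
    intro x
    rw [← mul_prod_erase univ _ (mem_univ v)]
    simp only [if_true]
    rw [sympFourier_one]
    have : ∏ u ∈ univ.erase v,
        sympFourier (if u = v then fun _ => 1 else onLine (T u)) (graphVec A x u) =
        2 ^ (Fintype.card V - 1) * ∏ u ∈ univ.erase v, onLine (T u) (graphVec A x u) := by
      rw [← Finset.card_univ, ← card_erase_of_mem (mem_univ v), ← prod_const, ← prod_mul_distrib]
      refine prod_congr rfl fun u hu => ?_
      rw [if_neg (ne_of_mem_erase hu), sympFourier_onLine _ _ (hT u (ne_of_mem_erase hu))]
    rw [this]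
    have hc : (2 : ℤ) ^ Fintype.card V = 2 * 2 ^ (Fintype.card V - 1) := by
      rw [← pow_succ', Nat.sub_add_cancel (Fintype.card_pos_iff.mpr ⟨v⟩)]
    rw [hc]; ring
  simp_rw [e1, e2, ← mul_sum] at h
  exact mul_left_cancel₀ (by positivity) h

/-- `(-2)` to the power of the dimension of `lineSpace A T`, extended by zero to the families `T`
with a zero entry. -/
noncomputable def signedCount (A : Matrix V V (ZMod 2)) (T : V → ZMod 2 × ZMod 2) : ℤ :=
  if ∀ v, T v ≠ 0 then (-2) ^ Module.finrank (ZMod 2) (lineSpace A T) else 0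

theorem sum_signedCount_update (A : Matrix V V (ZMod 2)) (hA : A.IsSymm)
    (T : V → ZMod 2 × ZMod 2) (v : V) :
    signedCount A (Function.update T v (0, 1)) + signedCount A (Function.update T v (1, 0)) +
      signedCount A (Function.update T v (1, 1)) = 0 := by
  by_cases hT : ∀ u ≠ v, T u ≠ 0
  · have hne : ∀ t : ZMod 2 × ZMod 2, t ≠ 0 → ∀ u, Function.update T v t u ≠ 0 := by
      intro t ht u
      by_cases hu : u = v
      · subst hu; simpa using ht
      · simpa [hu] using hT u hu
    simp only [signedCount]
    rw [if_pos (hne _ (by decide)), if_pos (hne _ (by decide)), if_pos (hne _ (by decide))]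
    -- The entry 0 at `v` imposes no condition there. The three lines together count each point of
    -- this larger space once, and twice more if it vanishes at `v`; the points vanishing at `v` are
    -- half of the space, whence the `+ 1`.
    apply neg_two_pow_add_eq_zero
      (e := Module.finrank (ZMod 2) (lineSpace A (Function.update T v 0)) + 1)
    zify
    rw [pow_succ]
    simp_rw [two_pow_finrank_lineSpace, prod_update_onLine]
    rw [← sum_add_distrib, ← sum_add_distrib]
    simp_rw [← add_mul, sum_onLine, add_mul, mul_assoc]
    rw [sum_add_distrib, ← mul_sum, ← mul_sum, two_mul_sum_eq_sum A hA T v hT]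
    simp [onLine, symp, mul_two]
  · push Not at hT
    obtain ⟨u, hu, h0⟩ := hT
    have : ∀ t, signedCount A (Function.update T v t) = 0 := by
      intro t
      rw [signedCount, if_neg]
      intro h
      exact h u (by simpa [hu] using h0)
    simp [this]

theorem signedCount_update_zero (A : Matrix V V (ZMod 2)) (T : V → ZMod 2 × ZMod 2) (v : V) :
    signedCount A (Function.update T v (0, 0)) = 0 := by
  rw [signedCount, if_neg]
  intro h
  exact h v (by simp)

/-- Coefficient functions that differ by a constant on the nonzero elements have the same sums
against `signedCount`. -/
theorem sum_prod_mul_signedCount_congr (A : Matrix V V (ZMod 2)) (hA : A.IsSymm)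
    (c c' : V → ZMod 2 × ZMod 2 → ℤ)
    (h : ∀ v, c v (0, 1) - c' v (0, 1) = c v (1, 1) - c' v (1, 1) ∧
      c v (1, 0) - c' v (1, 0) = c v (1, 1) - c' v (1, 1)) :
    ∑ z, (∏ v, c v (z v)) * signedCount A z = ∑ z, (∏ v, c' v (z v)) * signedCount A z := by
  refine sum_prod_mul_congr _ c c' fun v z => ?_
  rw [sum_pair_eq, sum_pair_eq, signedCount_update_zero]
  have h1 := sum_signedCount_update A hA z v
  linear_combination signedCount A (Function.update z v (0, 1)) * (h v).1 +
    signedCount A (Function.update z v (1, 0)) * (h v).2 +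
    (c v (1, 1) - c' v (1, 1)) * h1

theorem sum_prod_single {α : Type*} [Fintype α] [DecidableEq α] (a : V → α) (k : V → ℤ)
    (F : (V → α) → ℤ) :
    ∑ z, (∏ v, if z v = a v then k v else 0) * F z = (∏ v, k v) * F a := by
  rw [Finset.sum_eq_single a]
  · simp
  · intro b _ hb
    obtain ⟨v, hv⟩ := Function.ne_iff.mp hb
    rw [prod_eq_zero (mem_univ v) (by simp [hv]), zero_mul]
  · simp

/-! ### An odd multiple of a power of two -/

/-- The indicator function of the pairs of vectors with disjoint supports. -/
def disjointSupp (z y : V → ZMod 2) : ℤ := ∏ v, if z v * y v = 0 then 1 else 0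

/-- The image of a matrix, as a finite set. -/
def imageFinset (B : Matrix V V (ZMod 2)) : Finset (V → ZMod 2) := univ.image (B *ᵥ ·)

/-- The image of a symmetric `B` is the orthogonal complement of its kernel, so some `k` in the
kernel has `k ⬝ᵥ z ≠ 0`. Translating `x` by `k` then negates the sum. -/
theorem sum_eq_zero_of_notMem_image (B : Matrix V V (ZMod 2)) (hB : B.IsSymm) (z : V → ZMod 2)
    (hz : z ∉ imageFinset B) :
    ∑ x, disjointSupp z (B *ᵥ x) * sign (z ⬝ᵥ x) = 0 := by
  obtain ⟨φ, hφ, hr⟩ := Submodule.exists_le_ker_of_notMem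
    (p := LinearMap.range B.mulVecLin) (v := z) (by
      rintro ⟨x, hx⟩
      exact hz (mem_image.mpr ⟨x, mem_univ _, hx⟩))
  obtain ⟨k, rfl⟩ := (dotProductEquiv (ZMod 2) V).surjective φ
  simp only [dotProductEquiv_apply_apply] at hφ
  have hk : B *ᵥ k = 0 := by
    apply dotProduct_eq_zero
    intro x
    have : k ⬝ᵥ B *ᵥ x = 0 := hr ⟨x, rfl⟩
    rw [← hB.eq, mulVec_transpose, ← dotProduct_mulVec]
    exact this
  have h1 : sign (z ⬝ᵥ k) = -1 := by
    rw [dotProduct_comm]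
    simp [sign, hφ]
  have h := Equiv.sum_comp (Equiv.addRight k) fun x => disjointSupp z (B *ᵥ x) * sign (z ⬝ᵥ x)
  simp only [Equiv.coe_addRight, mulVec_add, hk, add_zero, dotProduct_add, sign_add, h1,
    mul_neg, mul_one, sum_neg_distrib] at h
  linarith

theorem sum_comp_mulVec (B : Matrix V V (ZMod 2)) (g : (V → ZMod 2) → ℤ) :
    ∑ x, g (B *ᵥ x) = 2 ^ Module.finrank (ZMod 2) (LinearMap.ker B.mulVecLin) *
      ∑ y ∈ imageFinset B, g y := by
  classical
  rw [sum_comp g (fun x => B *ᵥ x), mul_sum]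
  refine sum_congr rfl fun y hy => ?_
  obtain ⟨x, -, rfl⟩ := mem_image.mp hy
  rw [nsmul_eq_mul]
  congr 1
  have h := card_submodule_eq_two_pow (LinearMap.ker B.mulVecLin)
  rw [Nat.card_eq_fintype_card, Fintype.card_subtype] at h
  refine Eq.trans ?_ ((congrArg (Nat.cast (R := ℤ)) h).trans (by push_cast; rfl))
  rw [Nat.cast_inj]
  refine card_bij' (fun a _ => a - x) (fun a _ => a + x) ?_ ?_ ?_ ?_ <;>
    simp +contextual [mulVec_sub, mulVec_add]

-- Modulo 2 the signs disappear and the swap of `z` and `y` cancels all off-diagonal terms. On the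
-- diagonal only the zero vector has support disjoint from itself.
omit [DecidableEq V] in
theorem odd_sum_disjointSupp_mul_sign (R : Finset (V → ZMod 2)) (h0 : 0 ∈ R)
    (a : (V → ZMod 2) → (V → ZMod 2) → ZMod 2) :
    Odd (∑ z ∈ R, ∑ y ∈ R, disjointSupp z y * sign (a z y)) := by
  rw [← ZMod.intCast_eq_one_iff_odd]
  have hs : ∀ b, (sign b : ZMod 2) = 1 := by decide
  push_cast
  simp_rw [hs, mul_one]
  rw [← sum_product', ← add_sum_erase _ _ (mk_mem_product h0 h0)]
  have hz : ∑ p ∈ (R ×ˢ R).erase (0, 0), (disjointSupp p.1 p.2 : ZMod 2) = 0 := by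
    have hsymm : ∀ z y : V → ZMod 2, disjointSupp z y = disjointSupp y z := by
      intro z y; simp only [disjointSupp, mul_comm]
    refine sum_involution (fun p _ => p.swap) ?_ ?_ ?_ ?_
    · rintro ⟨z, y⟩ _
      rw [Prod.fst_swap, Prod.snd_swap, hsymm y z]
      exact CharTwo.add_self_eq_zero _
    · rintro ⟨z, y⟩ hp hne heq
      have hyz : y = z := congrArg Prod.fst heq
      subst hyz
      have hy : y ≠ 0 := fun h => by simp [h] at hp
      obtain ⟨v, hv⟩ := Function.ne_iff.mp hy
      apply hne
      have : disjointSupp y y = 0 :=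
        prod_eq_zero (mem_univ v) (by simpa using hv)
      simp [this]
    · rintro ⟨z, y⟩ hp
      simp only [mem_erase, mem_product, ne_eq, Prod.mk.injEq, Prod.swap_prod_mk] at hp ⊢
      tauto
    · intro p _
      exact p.swap_swap
  rw [hz]
  simp [disjointSupp]

theorem exists_odd_sum_disjointSupp (B : Matrix V V (ZMod 2)) (hB : B.IsSymm) :
    ∃ k : ℤ, Odd k ∧ ∑ z, ∑ x, disjointSupp z (B *ᵥ x) * sign (z ⬝ᵥ x) =
      k * 2 ^ Module.finrank (ZMod 2) (LinearMap.ker B.mulVecLin) := by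
  have hw : ∀ z, ∃ w, z ∈ imageFinset B → B *ᵥ w = z := by
    intro z
    by_cases hz : z ∈ imageFinset B
    · obtain ⟨w, -, hw⟩ := mem_image.mp hz
      exact ⟨w, fun _ => hw⟩
    · exact ⟨0, fun h => absurd h hz⟩
  -- For `z = B w`, symmetry gives `z ⬝ᵥ x = w ⬝ᵥ B x`, so the summand depends on `x` only through
  -- `B x`.
  choose w hw using hw
  refine ⟨_, odd_sum_disjointSupp_mul_sign (imageFinset B)
    (mem_image.mpr ⟨0, mem_univ _, mulVec_zero B⟩) fun z y => w z ⬝ᵥ y, ?_⟩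
  rw [← sum_subset (subset_univ (imageFinset B)) fun z _ hz =>
    sum_eq_zero_of_notMem_image B hB z hz, mul_comm, mul_sum]
  refine sum_congr rfl fun z hz => ?_
  rw [← sum_comp_mulVec B fun y => disjointSupp z y * sign (w z ⬝ᵥ y)]
  refine sum_congr rfl fun x _ => ?_
  rw [dotProduct_mulVec, ← mulVec_transpose, hB.eq, hw z hz]

/-! ### From graphs to line choices -/

omit [Fintype V] [DecidableEq V] in
theorem adjMatrix_of_adj {G : LoopGraph V} {x y : V} (h : G.Adj x y) : G.adjMatrix x y = 1 :=
  if_pos h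

omit [Fintype V] [DecidableEq V] in
theorem adjMatrix_of_not_adj {G : LoopGraph V} {x y : V} (h : ¬G.Adj x y) :
    G.adjMatrix x y = 0 :=
  if_neg h

omit [Fintype V] [DecidableEq V] in
theorem adjMatrix_isSymm (G : LoopGraph V) : G.adjMatrix.IsSymm := by
  ext x y
  rw [transpose_apply]
  by_cases h : G.Adj x y
  · rw [adjMatrix_of_adj h, adjMatrix_of_adj (G.symm x y h)]
  · rw [adjMatrix_of_not_adj h, adjMatrix_of_not_adj fun h' => h (G.symm y x h')]

/-- The choice of lines describing the graph `G + Y[X]`. -/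
def lineFamily (X Y : Finset V) (v : V) : ZMod 2 × ZMod 2 :=
  if v ∈ X then if v ∈ Y then (1, 1) else (1, 0) else (0, 1)

/-- Extension by zero identifies the two spaces: `(0, 1)` forces `x v = 0` outside `X`, while `(1,
0)` and `(1, 1)` express the kernel equation at `v` without and with a toggled loop. -/
theorem nullity_toggleLoops_induce (G : LoopGraph V) (X Y : Finset V) :
    ((G.toggleLoops Y).induce X).nullity =
      Module.finrank (ZMod 2) (lineSpace G.adjMatrix (lineFamily X Y)) := by
  have key : ∀ x : V → ZMod 2, (∀ v ∉ X, x v = 0) → ∀ v : X,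
      (((G.toggleLoops Y).induce X).adjMatrix *ᵥ fun u : X => x u) v =
        (G.adjMatrix *ᵥ x) v + if (v : V) ∈ Y then x v else 0 := by
    intro x hx v
    have e1 : (((G.toggleLoops Y).induce X).adjMatrix *ᵥ fun u : X => x u) v =
        ∑ u ∈ X, (G.toggleLoops Y).adjMatrix v u * x u := by
      rw [← sum_coe_sort X]
      rfl
    rw [e1, sum_subset (subset_univ X) fun u _ hu => by rw [hx u hu, mul_zero]]
    have e2 : ∀ u, (G.toggleLoops Y).adjMatrix v u =
        G.adjMatrix v u + if (v : V) = u ∧ (v : V) ∈ Y then 1 else 0 := by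
      intro u
      by_cases h1 : G.Adj v u <;> by_cases h2 : (v : V) = u ∧ (v : V) ∈ Y
      · rw [adjMatrix_of_adj h1, if_pos h2, adjMatrix_of_not_adj]
        · rfl
        · rintro (⟨-, h⟩ | ⟨-, h⟩) <;> contradiction
      · rw [adjMatrix_of_adj h1, if_neg h2, add_zero, adjMatrix_of_adj (Or.inl ⟨h1, h2⟩)]
      · rw [adjMatrix_of_not_adj h1, if_pos h2, zero_add, adjMatrix_of_adj (Or.inr ⟨h2, h1⟩)]
      · rw [adjMatrix_of_not_adj h1, if_neg h2, add_zero, adjMatrix_of_not_adj]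
        rintro (⟨h, -⟩ | ⟨h, -⟩) <;> contradiction
    simp_rw [e2, add_mul, sum_add_distrib]
    congr 1
    by_cases hv : (v : V) ∈ Y <;> simp [hv]
  have zero : ∀ x ∈ lineSpace G.adjMatrix (lineFamily X Y), ∀ v ∉ X, x v = 0 := by
    intro x hx v hv
    simpa [lineFamily, hv, symp, graphVec] using hx v
  unfold nullity
  symm
  apply LinearEquiv.finrank_eq
  refine LinearEquiv.ofBijective (LinearMap.codRestrict _
    ((LinearMap.funLeft (ZMod 2) (ZMod 2) (Subtype.val : X → V)).comp (Submodule.subtype _))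
      ?_) ⟨?_, ?_⟩
  · rintro ⟨x, hx⟩
    rw [LinearMap.mem_ker]
    ext v
    have := hx v
    rw [mulVecLin_apply]
    refine (key x (zero x hx) v).trans ?_
    by_cases hv : (v : V) ∈ Y <;> simpa [lineFamily, hv, symp, graphVec, add_comm] using this
  · rintro ⟨x, hx⟩ ⟨y, hy⟩ h
    apply Subtype.ext
    ext v
    by_cases hv : v ∈ X
    · exact congrFun (congrArg Subtype.val h) ⟨v, hv⟩
    · exact (zero x hx v hv).trans (zero y hy v hv).symm
  · rintro ⟨y, hy⟩
    have hy' : (fun u : X => (fun v => if h : v ∈ X then y ⟨v, h⟩ else 0 : V → ZMod 2) u) = y := by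
      ext u; simp
    refine ⟨⟨fun v => if h : v ∈ X then y ⟨v, h⟩ else 0, fun v => ?_⟩, Subtype.ext hy'⟩
    by_cases hv : v ∈ X
    · have h := key (fun v => if h : v ∈ X then y ⟨v, h⟩ else 0) (fun v hv => by simp [hv]) ⟨v, hv⟩
      rw [hy'] at h
      have h2 := congrFun (LinearMap.mem_ker.mp hy) ⟨v, hv⟩
      rw [mulVecLin_apply, h] at h2
      by_cases hY : v ∈ Y <;> simpa [lineFamily, hv, hY, symp, graphVec, add_comm] using h2
    · simp [lineFamily, hv, symp, graphVec]

omit [Fintype V] in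
theorem lineFamily_ne_zero (X Y : Finset V) (v : V) : lineFamily X Y v ≠ 0 := by
  unfold lineFamily
  split_ifs <;> decide

/-- Functions to `GF(2)` are the same as finite sets. -/
def supportEquiv : (V → ZMod 2) ≃ Finset V where
  toFun x := univ.filter fun v => x v = 1
  invFun X v := if v ∈ X then 1 else 0
  left_inv x := by
    ext v
    have : ∀ a : ZMod 2, (if a = 1 then (1 : ZMod 2) else 0) = a := by decide
    simpa using this (x v)
  right_inv X := by ext v; simp

theorem mem_supportEquiv {x : V → ZMod 2} {v : V} : v ∈ supportEquiv x ↔ x v = 1 := by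
  simp [supportEquiv]

theorem sum_powerset_lineFamily (φ : (V → ZMod 2 × ZMod 2) → ℤ) :
    ∑ X : Finset V, ∑ Y ∈ X.powerset, φ (lineFamily X Y) =
      ∑ T, (∏ v, if T v ≠ 0 then 1 else 0) * φ T := by
  simp_rw [Finset.prod_ite_zero, prod_const_one, ite_mul, one_mul, zero_mul]
  rw [← sum_filter, sum_sigma']
  refine sum_bij' (fun p _ => lineFamily p.1 p.2)
    (fun T _ => ⟨univ.filter fun v => (T v).1 = 1, univ.filter fun v => T v = (1, 1)⟩) ?_ ?_ ?_ ?_ ?_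
  · rintro ⟨X, Y⟩ _
    simp [lineFamily_ne_zero]
  · intro T _
    simp only [mem_sigma, mem_univ, mem_powerset, true_and]
    intro v
    simp only [mem_filter, mem_univ, true_and]
    intro h; rw [h]
  · rintro ⟨X, Y⟩ h
    have hYX : Y ⊆ X := by simpa using h
    have e1 : (univ.filter fun v => (lineFamily X Y v).1 = 1) = X := by
      ext v
      rw [mem_filter_univ, lineFamily]
      split_ifs <;> simp_all
    have e2 : (univ.filter fun v => lineFamily X Y v = (1, 1)) = Y := by
      ext v
      have := @hYX v
      rw [mem_filter_univ, lineFamily]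
      split_ifs <;> simp_all
    simp only [e1, e2]
  · intro T hT
    ext1 v
    have hv : T v ≠ 0 := by simpa using (mem_filter.mp hT).2 v
    have : ∀ t : ZMod 2 × ZMod 2, t ≠ 0 →
        (if t.1 = 1 then if t = (1, 1) then ((1 : ZMod 2), (1 : ZMod 2)) else (1, 0) else (0, 1)) = t := by
      decide
    simpa [lineFamily] using this (T v) hv
  · simp

theorem sum_lineFamily_empty (φ : (V → ZMod 2 × ZMod 2) → ℤ) :
    ∑ X : Finset V, φ (lineFamily X ∅) =
      ∑ T, (∏ v, if T v = (0, 1) ∨ T v = (1, 0) then 1 else 0) * φ T := by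
  simp_rw [Finset.prod_ite_zero, prod_const_one, ite_mul, one_mul, zero_mul]
  rw [← sum_filter]
  refine sum_bij' (fun X _ => lineFamily X ∅) (fun T _ => univ.filter fun v => (T v).1 = 1)
    ?_ ?_ ?_ ?_ ?_
  · intro X _
    simp only [mem_filter, mem_univ, true_and, lineFamily]
    intro v _
    split_ifs <;> simp_all
  · simp
  · intro X _
    ext v
    rw [mem_filter_univ, lineFamily]
    split_ifs <;> simp_all
  · intro T hT
    ext1 v
    have hv := (mem_filter.mp hT).2 v (mem_univ v)
    rcases hv with hv | hv <;> simp [lineFamily, hv]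
  · simp

theorem interlacePoly_eval (G : LoopGraph V) (y : ℤ) :
    G.interlacePoly.eval y = ∑ T, (∏ v, if T v = (0, 1) ∨ T v = (1, 0) then 1 else 0) *
      (y - 1) ^ Module.finrank (ZMod 2) (lineSpace G.adjMatrix T) := by
  rw [← sum_lineFamily_empty fun T => (y - 1) ^ Module.finrank (ZMod 2) (lineSpace G.adjMatrix T)]
  have : G.toggleLoops ∅ = G := by
    cases G; simp [toggleLoops, Xor]
  simp_rw [← nullity_toggleLoops_induce, this]
  simp [interlacePoly, Polynomial.eval_finsetSum]

theorem globalInterlacePoly_eval (G : LoopGraph V) (y : ℤ) :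
    G.globalInterlacePoly.eval y = ∑ T, (∏ v, if T v ≠ 0 then 1 else 0) *
      (y - 2) ^ Module.finrank (ZMod 2) (lineSpace G.adjMatrix T) := by
  rw [← sum_powerset_lineFamily
    fun T => (y - 2) ^ Module.finrank (ZMod 2) (lineSpace G.adjMatrix T)]
  simp_rw [← nullity_toggleLoops_induce]
  simp [globalInterlacePoly, Polynomial.eval_finsetSum]

theorem mulVec_eq_card (G : LoopGraph V) (x : V → ZMod 2) (v : V) :
    (G.adjMatrix *ᵥ x) v = ((G.neighbors v ∩ supportEquiv x).card : ZMod 2) := by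
  classical
  have h : G.neighbors v ∩ supportEquiv x = univ.filter fun u => G.Adj v u ∧ x u = 1 := by
    ext u
    simp [neighbors, mem_supportEquiv]
  rw [h, natCast_card_filter]
  refine sum_congr rfl fun u _ => ?_
  have key : ∀ a : ZMod 2, a = if a = 1 then 1 else 0 := by decide
  by_cases hu : G.Adj v u
  · simpa [adjMatrix, hu] using key (x u)
  · simp [adjMatrix, hu]

theorem mem_eul_iff (G : LoopGraph V) (hG : G.IsSimple) (x : V → ZMod 2) :
    supportEquiv x ∈ G.eul ↔ ∀ v, graphVec G.adjMatrix x v ≠ (1, 1) := by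
  have h1 : ∀ v : supportEquiv x, ((G.induce (supportEquiv x)).neighbors v).card =
      (G.neighbors v ∩ supportEquiv x).card := by
    intro v
    refine card_bij (fun u _ => (u : V)) ?_ ?_ ?_
    · intro u hu
      simp only [neighbors, mem_filter, mem_univ, true_and, mem_inter] at hu ⊢
      exact ⟨hu, u.2⟩
    · intro u _ w _ h
      exact Subtype.ext h
    · intro u hu
      simp only [neighbors, mem_filter, mem_univ, true_and, mem_inter] at hu ⊢
      exact ⟨⟨u, hu.2⟩, hu.1, rfl⟩
  have h2 : (G.induce (supportEquiv x)).IsSimple := fun v => hG v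
  have h3 : supportEquiv x ∈ G.eul ↔ (G.induce (supportEquiv x)).IsEulerian := by
    classical
    unfold eul
    rw [mem_filter_univ]
  rw [h3]
  simp only [IsEulerian, h2, h1, true_and, ← ZMod.natCast_eq_zero_iff_even,
    ← mulVec_eq_card, Subtype.forall, mem_supportEquiv, graphVec]
  have : ∀ a b : ZMod 2, (a = 1 → b = 0) ↔ (a, b) ≠ (1, 1) := by decide
  exact forall_congr' fun v => this _ _

theorem sum_eul (G : LoopGraph V) (hG : G.IsSimple) (φ : Finset V → ℤ) :
    ∑ X ∈ G.eul, φ X =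
      ∑ x, (∏ v, if graphVec G.adjMatrix x v ≠ (1, 1) then 1 else 0) * φ (supportEquiv x) := by
  simp_rw [Finset.prod_ite_zero, prod_const_one, ite_mul, one_mul, zero_mul]
  rw [← sum_filter]
  symm
  refine sum_equiv supportEquiv (fun x => ?_) (fun _ _ => rfl)
  simp [mem_eul_iff G hG]

/-! ### The values of the interlace polynomial -/

omit [DecidableEq V] in
theorem prod_mul_signedCount (A : Matrix V V (ZMod 2)) (c : V → ZMod 2 × ZMod 2 → ℤ)
    (hc : ∀ v, c v 0 = 0) (T : V → ZMod 2 × ZMod 2) :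
    (∏ v, c v (T v)) * signedCount A T =
      (∏ v, c v (T v)) * (-2) ^ Module.finrank (ZMod 2) (lineSpace A T) := by
  rw [signedCount]
  split_ifs with h
  · rfl
  · push Not at h
    obtain ⟨v, hv⟩ := h
    rw [prod_eq_zero (mem_univ v) (by rw [hv, hc]), zero_mul, zero_mul]

theorem sum_prod_mul_two_pow (A : Matrix V V (ZMod 2)) (c : V → ZMod 2 × ZMod 2 → ℤ) :
    ∑ T, (∏ v, c v (T v)) * 2 ^ Module.finrank (ZMod 2) (lineSpace A T) =
      ∑ x, ∏ v, ∑ t, c v t * onLine t (graphVec A x v) := by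
  simp_rw [two_pow_finrank_lineSpace, mul_sum, ← prod_mul_distrib]
  rw [sum_comm]
  refine sum_congr rfl fun x _ => ?_
  rw [sum_prod_eq_prod_sum fun v t => c v t * onLine t (graphVec A x v)]

theorem interlacePoly_eval_neg_one (G : LoopGraph V) :
    G.interlacePoly.eval (-1) = (-1) ^ Fintype.card V *
      (-2) ^ Module.finrank (ZMod 2) (lineSpace G.adjMatrix fun _ => (1, 1)) := by
  rw [interlacePoly_eval]
  norm_num only
  simp_rw [← prod_mul_signedCount G.adjMatrix
    (fun _ t => if t = (0, 1) ∨ t = (1, 0) then 1 else 0) (fun _ => by decide)]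
  -- At each vertex the lines `(0, 1)` and `(1, 0)` together are traded for minus the line `(1, 1)`,
  -- leaving a single term.
  rw [sum_prod_mul_signedCount_congr _ G.adjMatrix_isSymm
    (fun _ t => if t = (0, 1) ∨ t = (1, 0) then 1 else 0) (fun _ t => if t = (1, 1) then -1 else 0) (fun _ => by decide),
    sum_prod_single (fun _ => (1, 1)) (fun _ => -1), signedCount, if_pos fun _ => by decide]
  simp

theorem exists_odd_interlacePoly_eval_three (G : LoopGraph V) :
    ∃ k : ℤ, Odd k ∧ G.interlacePoly.eval 3 = k * |G.interlacePoly.eval (-1)| := by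
  have hB : (G.adjMatrix + 1).IsSymm := G.adjMatrix_isSymm.add isSymm_one
  obtain ⟨k, hk, h⟩ := exists_odd_sum_disjointSupp _ hB
  refine ⟨k, hk, ?_⟩
  have hker : LinearMap.ker (G.adjMatrix + 1).mulVecLin =
      lineSpace G.adjMatrix fun _ => (1, 1) := by
    ext x
    rw [LinearMap.mem_ker, mulVecLin_apply, mem_lineSpace, funext_iff]
    simp [add_mulVec, symp, graphVec, add_comm]
  rw [hker] at h
  rw [interlacePoly_eval_neg_one, abs_mul, abs_pow, abs_pow, abs_neg, abs_neg, abs_one, one_pow,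
    one_mul, abs_two, ← h, interlacePoly_eval]
  norm_num only
  rw [sum_prod_mul_two_pow G.adjMatrix fun _ t => if t = (0, 1) ∨ t = (1, 0) then 1 else 0,
    sum_comm]
  refine sum_congr rfl fun x _ => ?_
  -- The number of the two axes through `w`, written as a sum over one bit `s`. These bits form the
  -- vector `z` of `exists_odd_sum_disjointSupp`, and `w.2 + w.1` is the entry of `(A + 1) x`.
  have key : ∀ w : ZMod 2 × ZMod 2,
      (∑ t, (if t = (0, 1) ∨ t = (1, 0) then 1 else 0) * onLine t w) =
        ∑ s : ZMod 2, (if s * (w.2 + w.1) = 0 then 1 else 0) * sign (s * w.1) := by decide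
  simp_rw [key]
  rw [← sum_prod_eq_prod_sum fun v s =>
    (if s * ((graphVec G.adjMatrix x v).2 + (graphVec G.adjMatrix x v).1) = 0 then 1 else 0) *
      sign (s * (graphVec G.adjMatrix x v).1)]
  refine sum_congr rfl fun z _ => ?_
  rw [prod_mul_distrib, ← sign_sum]
  simp only [disjointSupp, graphVec, add_mulVec, one_mulVec, Pi.add_apply, dotProduct]
  rfl

/-! ### The values of the global interlace polynomial of a simple graph -/

omit [DecidableEq V] in
theorem sum_mul_mul_eq_zero {A : Matrix V V (ZMod 2)} (hA : A.IsSymm) (h0 : ∀ v, A v v = 0)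
    (x : V → ZMod 2) : ∑ v, x v * (A *ᵥ x) v = 0 := by
  simp_rw [mulVec, dotProduct, mul_sum]
  rw [← sum_product']
  refine sum_involution (fun p _ => p.swap) ?_ ?_ ?_ ?_
  · rintro ⟨u, v⟩ _
    simp only [Prod.swap_prod_mk, hA.apply u v]
    rw [show x v * (A u v * x u) = x u * (A u v * x v) by ring]
    exact CharTwo.add_self_eq_zero _
  · rintro ⟨u, v⟩ _ hne heq
    have huv : v = u := congrArg Prod.fst heq
    subst huv
    simp [h0] at hne
  · simp
  · intro p _
    exact p.swap_swap

omit [DecidableEq V] in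
theorem prod_sign_graphVec {G : LoopGraph V} (hG : G.IsSimple) (x : V → ZMod 2) :
    ∏ v, sign ((graphVec G.adjMatrix x v).1 * (graphVec G.adjMatrix x v).2) = 1 := by
  rw [← sign_sum]
  simp only [graphVec]
  rw [sum_mul_mul_eq_zero G.adjMatrix_isSymm fun v => by simp [adjMatrix, hG v]]
  rfl

theorem globalInterlacePoly_eval_four (G : LoopGraph V) (hG : G.IsSimple) :
    G.globalInterlacePoly.eval 4 = (G.eul.card : ℤ) * 2 ^ Fintype.card V := by
  have h := sum_prod_sympFourier G.adjMatrix G.adjMatrix_isSymm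
    fun _ z => if z ≠ (1, 1) then 1 else 0
  have he : (G.eul.card : ℤ) = ∑ X ∈ G.eul, 1 := by simp
  rw [he, sum_eul G hG, mul_comm]
  simp_rw [mul_one]
  rw [← h, globalInterlacePoly_eval]
  norm_num only
  rw [sum_prod_mul_two_pow G.adjMatrix fun _ t => if t ≠ 0 then 1 else 0]
  refine sum_congr rfl fun x _ => ?_
  -- The transform of the indicator of `z ≠ (1, 1)` at `w` is the number of lines through `w` times
  -- `sign (w.1 * w.2)`; the missing signs are inserted as a product equal to 1.
  refine ((mul_one _).symm.trans (congrArg _ (prod_sign_graphVec hG x).symm)).trans ?_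
  rw [← prod_mul_distrib]
  refine prod_congr rfl fun v _ => ?_
  generalize graphVec G.adjMatrix x v = w
  revert w
  decide

/-- The weight of a pair of entries in the sum over pairs of Eulerian sets. -/
def pairWeight (z w : ZMod 2 × ZMod 2) : ℤ :=
  if z = (1, 1) ∨ w = (1, 1) then 0 else if z = w then 2 else 1

/-- Transforming in both variables turns `pairWeight` into the number of lines containing both
points, up to signs whose product over `V` is 1. The factor 4 per vertex matches two Poisson
summations. -/
theorem sympFourier_pairWeight (z w : ZMod 2 × ZMod 2) :
    sympFourier (fun b => sympFourier (fun a => pairWeight a b) z) w =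
      4 * (sign (z.1 * z.2) * sign (w.1 * w.2) *
        ∑ t, (if t ≠ 0 then 1 else 0) * (onLine t z * onLine t w)) := by
  revert z w; decide

theorem two_pow_card_PN (G : LoopGraph V) (x y : V → ZMod 2) :
    (∏ v, if graphVec G.adjMatrix x v ≠ (1, 1) then 1 else 0) *
      ((∏ v, if graphVec G.adjMatrix y v ≠ (1, 1) then 1 else 0) *
        (2 : ℤ) ^ (G.PN (supportEquiv x) (supportEquiv y)).card) =
      ∏ v, pairWeight (graphVec G.adjMatrix x v) (graphVec G.adjMatrix y v) := by
  have h : G.PN (supportEquiv x) (supportEquiv y) =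
      univ.filter fun v => graphVec G.adjMatrix x v = graphVec G.adjMatrix y v := by
    ext v
    have h2 : ∀ a b : ZMod 2, (¬((a = 1 ∧ ¬b = 1) ∨ (b = 1 ∧ ¬a = 1))) ↔ a = b := by decide
    simp only [PN, mem_filter, mem_sdiff, mem_univ, true_and, mem_symmDiff, mem_supportEquiv,
      graphVec, Prod.mk.injEq, mulVec_eq_card, ZMod.natCast_eq_natCast_iff, h2]
  rw [h, ← prod_const, prod_filter, ← prod_mul_distrib, ← prod_mul_distrib]
  refine prod_congr rfl fun v _ => ?_
  generalize graphVec G.adjMatrix x v = z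
  generalize graphVec G.adjMatrix y v = w
  revert z w
  decide

theorem globalInterlacePoly_eval_six (G : LoopGraph V) (hG : G.IsSimple) :
    G.globalInterlacePoly.eval 6 =
      ∑ X₁ ∈ G.eul, ∑ X₂ ∈ G.eul, (2 : ℤ) ^ (G.PN X₁ X₂).card := by
  have hA := G.adjMatrix_isSymm
  simp_rw [sum_eul G hG, mul_sum, two_pow_card_PN]
  have h4 : (4 : ℤ) ^ Fintype.card V = 2 ^ Fintype.card V * 2 ^ Fintype.card V := by
    rw [← mul_pow]; norm_num
  apply mul_left_cancel₀ (pow_ne_zero (Fintype.card V) (four_ne_zero' ℤ))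
  have hR : ∑ y, ∑ x, ∏ v, sympFourier
        (fun b => sympFourier (fun a => pairWeight a b) (graphVec G.adjMatrix x v))
        (graphVec G.adjMatrix y v) =
      4 ^ Fintype.card V *
        ∑ x, ∑ y, ∏ v, pairWeight (graphVec G.adjMatrix x v) (graphVec G.adjMatrix y v) := by
    rw [sum_comm]
    simp_rw [sum_prod_sympFourier G.adjMatrix hA fun v b =>
      sympFourier (fun a => pairWeight a b) (graphVec G.adjMatrix _ v)]
    rw [← mul_sum, sum_comm]
    simp_rw [sum_prod_sympFourier G.adjMatrix hA fun v a =>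
      pairWeight a (graphVec G.adjMatrix _ v)]
    rw [← mul_sum, ← mul_assoc, ← h4, sum_comm]
  rw [← hR, globalInterlacePoly_eval]
  norm_num only
  -- Each factor `2 ^ d` is counted by its own point of `L`, giving the pairs `x`, `y`.
  have h2 : ∀ d : ℕ, (4 : ℤ) ^ d = 2 ^ d * 2 ^ d := fun d => by rw [← mul_pow]; norm_num
  simp_rw [h2 (Module.finrank _ _), two_pow_finrank_lineSpace, sum_mul_sum, mul_sum,
    ← prod_mul_distrib]
  rw [sum_comm]
  refine sum_congr rfl fun y _ => ?_
  rw [sum_comm]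
  refine sum_congr rfl fun x _ => ?_
  rw [← mul_sum, sum_prod_eq_prod_sum fun v t => (if t ≠ 0 then 1 else 0) *
    (onLine t (graphVec G.adjMatrix y v) * onLine t (graphVec G.adjMatrix x v))]
  simp_rw [sympFourier_pairWeight, prod_mul_distrib, prod_sign_graphVec hG, prod_const,
    Finset.card_univ, one_mul]
  simp_rw [mul_comm (onLine _ (graphVec G.adjMatrix x _))]

/-- Turns the Eulerian sum into a sum of `signedCount` over the translate of `L` by the constant
family `(1, 1)`. -/
theorem lineFamily_compl_evenSet (G : LoopGraph V) (x : V → ZMod 2)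
    (hx : ∀ v, graphVec G.adjMatrix x v ≠ (1, 1)) :
    lineFamily (univ \ supportEquiv x) (G.evenSet (supportEquiv x)) =
      fun v => graphVec G.adjMatrix x v + (1, 1) := by
  ext1 v
  have h := hx v
  simp only [lineFamily, evenSet, mem_filter, mem_sdiff, mem_univ, true_and, mem_supportEquiv,
    ← ZMod.natCast_eq_zero_iff_even, ← mulVec_eq_card]
  simp only [graphVec] at h ⊢
  generalize x v = a at h ⊢
  generalize (G.adjMatrix *ᵥ x) v = b at h ⊢
  revert a b
  decide

theorem sum_eul_signedCount (G : LoopGraph V) (hG : G.IsSimple) :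
    ∑ X ∈ G.eul,
        (-2 : ℤ) ^ ((G.toggleLoops (G.evenSet X)).induce (Finset.univ \ X)).nullity =
      ∑ x, signedCount G.adjMatrix fun v => graphVec G.adjMatrix x v + (1, 1) := by
  rw [sum_eul G hG]
  refine sum_congr rfl fun x _ => ?_
  rw [nullity_toggleLoops_induce, Finset.prod_ite_zero, prod_const_one, ite_mul, one_mul, zero_mul,
    signedCount]
  have h2 : ∀ w : ZMod 2 × ZMod 2, w ≠ (1, 1) ↔ w + (1, 1) ≠ 0 := by decide
  simp_rw [← h2]
  by_cases h : ∀ v, graphVec G.adjMatrix x v ≠ (1, 1)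
  · rw [if_pos fun v _ => h v, if_pos h, lineFamily_compl_evenSet G x h]
  · rw [if_neg fun h' => h fun v => h' v (mem_univ v), if_neg h]

theorem globalInterlacePoly_eval_neg_two (G : LoopGraph V) (hG : G.IsSimple) :
    G.globalInterlacePoly.eval (-2) = (-1) ^ Fintype.card V *
      ∑ X ∈ G.eul,
        (-2) ^ ((G.toggleLoops (G.evenSet X)).induce (Finset.univ \ X)).nullity := by
  have hA := G.adjMatrix_isSymm
  rw [sum_eul_signedCount G hG]
  have hL : G.globalInterlacePoly.eval (-2) =
      ∑ x, signedCount G.adjMatrix (graphVec G.adjMatrix x) := by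
    rw [globalInterlacePoly_eval]
    norm_num only
    have h4 : ∀ d : ℕ, (-4 : ℤ) ^ d = (-2) ^ d * 2 ^ d := fun d => by rw [← mul_pow]; norm_num
    simp_rw [h4, ← mul_assoc]
    simp_rw [← prod_mul_signedCount G.adjMatrix (fun _ t => if t ≠ 0 then 1 else 0)
      (fun _ => by decide), two_pow_finrank_lineSpace, mul_sum]
    rw [sum_comm]
    refine sum_congr rfl fun x _ => ?_
    simp_rw [mul_right_comm _ (signedCount _ _), ← prod_mul_distrib]
    -- With `w = graphVec G.adjMatrix x v`: if `w ≠ 0`, the only line through `w` is its own; if `w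
    -- = 0`, the coefficient is constant on the three lines and may be dropped. The second power of
    -- 2 thus selects `T = graphVec G.adjMatrix x`.
    rw [sum_prod_mul_signedCount_congr _ hA
      (fun v t => (if t ≠ 0 then 1 else 0) * onLine t (graphVec G.adjMatrix x v))
      (fun v t => if t = graphVec G.adjMatrix x v then 1 else 0), sum_prod_single]
    · simp
    · intro v
      generalize graphVec G.adjMatrix x v = w
      revert w
      decide
  rw [hL]
  apply mul_left_cancel₀ (pow_ne_zero (Fintype.card V) (two_ne_zero' ℤ))
  rw [mul_left_comm, ← sum_prod_symp G.adjMatrix hA fun z =>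
    signedCount G.adjMatrix fun v => z v + (1, 1), mul_sum, mul_sum]
  refine sum_congr rfl fun x _ => ?_
  have hshift := Equiv.sum_comp (Equiv.addRight fun _ : V => ((1, 1) : ZMod 2 × ZMod 2)) fun z =>
    (∏ v, sign (symp (z v + (1, 1)) (graphVec G.adjMatrix x v))) * signedCount G.adjMatrix z
  have hcancel : ∀ a : ZMod 2 × ZMod 2, a + (1, 1) + (1, 1) = a := by decide
  simp only [Equiv.coe_addRight, Pi.add_apply, hcancel] at hshift
  refine Eq.trans ?_ (congrArg _ hshift.symm)
  -- For `w ≠ 0`, `sign (symp t w)` on nonzero `t` is twice the indicator of `t = w` minus 1, and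
  -- the constant may be dropped; for `w = 0` all of it is constant.
  rw [sum_prod_mul_signedCount_congr _ hA
    (fun v t => sign (symp (t + (1, 1)) (graphVec G.adjMatrix x v)))
    (fun v t => if t = graphVec G.adjMatrix x v
      then 2 * sign (symp (1, 1) (graphVec G.adjMatrix x v)) else 0), sum_prod_single]
  · by_cases h0 : ∀ v, graphVec G.adjMatrix x v ≠ 0
    · have hs : ∏ v, 2 * sign (symp (1, 1) (graphVec G.adjMatrix x v)) =
          ∏ v, (-2) *
            sign ((graphVec G.adjMatrix x v).1 * (graphVec G.adjMatrix x v).2) := by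
        refine prod_congr rfl fun v _ => ?_
        have := h0 v
        generalize graphVec G.adjMatrix x v = w at this ⊢
        revert w
        decide
      rw [hs, prod_mul_distrib, prod_sign_graphVec hG, prod_const, Finset.card_univ, mul_one,
        ← mul_assoc, ← mul_pow]
      norm_num
    · have : signedCount G.adjMatrix (graphVec G.adjMatrix x) = 0 := if_neg h0
      simp [this]
  · intro v
    generalize graphVec G.adjMatrix x v = w
    revert w
    decide

end LoopGraph

theorem mainTheorem10 {V : Type*} [Fintype V] [DecidableEq V] (G : LoopGraph V) :
    (∃ k : ℤ, Odd k ∧ G.interlacePoly.eval 3 = k * |G.interlacePoly.eval (-1)|) ∧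
    (G.IsSimple →
      G.globalInterlacePoly.eval 4 = (G.eul.card : ℤ) * 2 ^ Fintype.card V ∧
      G.globalInterlacePoly.eval 6 =
        ∑ X₁ ∈ G.eul, ∑ X₂ ∈ G.eul, (2 : ℤ) ^ (G.PN X₁ X₂).card ∧
      G.globalInterlacePoly.eval (-2) =
        (-1) ^ Fintype.card V *
          ∑ X ∈ G.eul,
            (-2) ^ ((G.toggleLoops (G.evenSet X)).induce (Finset.univ \ X)).nullity) :=
  ⟨G.exists_odd_interlacePoly_eval_three, fun hG => ⟨G.globalInterlacePoly_eval_four hG,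
    G.globalInterlacePoly_eval_six hG, G.globalInterlacePoly_eval_neg_two hG⟩⟩
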